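/- Let $\mathcal T_*$ be the category of pointed connected compactly generated spaces and base-point preserving continuous maps, and $\operatorname{ho}\mathcal T_*$ the category with the same objects whose morphisms are pointed homotopy classes $[f]$ of maps. A *lattice* is a non-unital category $\Gamma$ with finitely many objects and arrows, no arrow from an object to itself, two objects $v_{\rm init}, v_{\rm fin}$ such that every object $w\ne v_{\rm init}$ receives an arrow from $v_{\rm init}$ and every object $w\neq v_{\rm fin}$ has an arrow to $v_{\rm fin}$, exactly one arrow $\phi_{\max}\colon v_{\rm init}\to v_{\rm fin}$, and at least one object different from $v_{\rm init}$ and $v_{\rm fin}$. The category $W\Gamma$ has the objects of $\Gamma$, and $W\Gamma(u,v)$ is the quotient space of $\bigsqcup_{n\ge 0}\Gamma_{n+1}(u,v)\times[0,1]^n$, where $\Gamma_{n+1}(u,v)$ is the discrete set of chains $u\xrightarrow{f_{n+1}}v_n\to\cdots\to v_1\xrightarrow{f_1}v$ in $\Gamma$; a point is written $f_1\circ_{t_1}f_2\circ_{t_2}\cdots\circ_{t_n}f_{n+1}$, and whenever $t_i=0$ it is identified with the point in which $f_i\circ_{0}f_{i+1}$ is replaced by the composite $f_if_{i+1}$. Composition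 in $W\Gamma$ is concatenation with parameter $1$: $(p,q)\mapsto p\circ_1 q$. An arrow $f$ of $\Gamma$ is identified with the point $f$ of $W\Gamma$ given by the $1$-chain $f$. The subcategory $bW\Gamma\subset W\Gamma$ has all objects, $bW\Gamma(u,v)=W\Gamma(u,v)$ for $(u,v)\ne(v_{\rm init},v_{\rm fin})$, and $bW\Gamma(v_{\rm init},v_{\rm fin})$ consists of the composites $\alpha\circ\beta$ with $\beta\in W\Gamma(v_{\rm init},w)$, $\alpha\in W\Gamma(w,v_{\rm fin})$, $v_{\rm init}\ne w\ne v_{\rm fin}$. Its $0$-skeleton $\operatorname{sk}_0 bW\Gamma$ is the subcategory generated by the vertices (points with all $t_i\in\{0,1\}$) that lie in $bW\Gamma$. A functor $F$ from a subcategory $U$ of $W\Gamma$ to $\mathcal T_*$ is always meant to be continuous: it preserves composition, and the maps $U(u,v)\times F(u)\to F(v)$ are continuous. Let $\Gamma$ be a lattice and $\mathcal A\colon\Gamma\to\operatorname{ho}\mathcal T_*$ a functor. A *$0$-realization* of $\mathcal A$ is a functor $\bar{\mathcal A}_0\colon\operatorname{sk}_0 bW\Gamma\to\mathcal T_*$ with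 $\bar{\mathcal A}_0(v)=\mathcal A(v)$ for every object $v$ and $[\bar{\mathcal A}_0(f)]=\mathcal A(f)$ for every arrow $f\neq\phi_{\max}$ of $\Gamma$. **Proposition.** Suppose that some $0$-realization $\bar{\mathcal A}_0\colon\operatorname{sk}_0 bW\Gamma\to\mathcal T_*$ of $\mathcal A$ extends to a functor $\mathcal B\colon W\Gamma\to\mathcal T_*$. Then every $0$-realization $\bar{\mathcal A}_0'$ of $\mathcal A$ extends to some functor $\mathcal B'\colon W\Gamma\to\mathcal T_*$. -/

import Mathlib

universe u v w

namespace HigherOps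

open scoped unitInterval

/-! ### Pointed spaces and their homotopy category -/

/-- A pointed connected compactly generated space (an object of `𝒯_*`). -/
structure PtSpace where
  carrier : Type w
  [top : TopologicalSpace carrier]
  [compactlyGenerated : CompactlyGeneratedSpace carrier]
  [connected : ConnectedSpace carrier]
  base : carrier

instance : CoeSort PtSpace.{w} (Type w) := ⟨PtSpace.carrier⟩

attribute [instance] PtSpace.top PtSpace.compactlyGenerated PtSpace.connected

/-- A morphism of `𝒯_*`: a continuous map that preserves the base point. -/
@[ext]
structure PtMap (X Y : PtSpace.{w}) where
  toMap : C(X, Y)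
  map_base : toMap X.base = Y.base

/-- Composition in `𝒯_*`. -/
def PtMap.comp {X Y Z : PtSpace.{w}} (g : PtMap Y Z) (f : PtMap X Y) : PtMap X Z where
  toMap := g.toMap.comp f.toMap
  map_base := by simp [f.map_base, g.map_base]

/-- Two pointed maps are homotopic if there is a homotopy between them that fixes the base point. -/
def PtMap.setoid (X Y : PtSpace.{w}) : Setoid (PtMap X Y) where
  r f g := ContinuousMap.HomotopicRel f.toMap g.toMap {X.base}
  iseqv := ⟨fun f => .refl f.toMap, fun h => h.symm, fun h k => h.trans k⟩

/-- The morphisms `X ⟶ Y` of `ho 𝒯_*`: pointed homotopy classes of pointed maps. The objects of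
`ho 𝒯_*` are those of `𝒯_*`. -/
def HoMap (X Y : PtSpace.{w}) : Type w := Quotient (PtMap.setoid X Y)

/-- The homotopy class of a pointed map. -/
def PtMap.cls {X Y : PtSpace.{w}} (f : PtMap X Y) : HoMap X Y := Quotient.mk _ f

/-- Composition in `ho 𝒯_*`. -/
def HoMap.comp {X Y Z : PtSpace.{w}} (g : HoMap Y Z) (f : HoMap X Y) : HoMap X Z :=
  Quotient.map₂ PtMap.comp (by
    rintro g g' ⟨G⟩ f f' ⟨F⟩
    refine ⟨⟨G.toHomotopy.comp F.toHomotopy, ?_⟩⟩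
    rintro t x rfl
    have h1 := F.eq_fst t (Set.mem_singleton X.base)
    have h2 := G.eq_fst t (Set.mem_singleton Y.base)
    change G (t, F (t, X.base)) = g.toMap (f.toMap X.base)
    rw [h1, f.map_base, h2]) g f

/-! ### Lattices -/

/-- A lattice on the set of nodes `V`: a finite directed category, treated as a nonunital category
(so there is no arrow from a node to itself), with a weakly initial node `init`, a weakly terminal
node `fin`, exactly one arrow from `init` to `fin`, and at least one further node. -/
structure DiagramLattice (V : Type u) where
  Hom : V → V → Type v
  comp : ∀ {a b c : V}, Hom b c → Hom a b → Hom a c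
  assoc : ∀ {a b c d : V} (h : Hom c d) (g : Hom b c) (f : Hom a b),
    comp (comp h g) f = comp h (comp g f)
  finite_nodes : Finite V
  finite_hom : ∀ a b : V, Finite (Hom a b)
  directed : ∀ a : V, IsEmpty (Hom a a)
  init : V
  fin : V
  weak_init : ∀ a : V, a ≠ init → Nonempty (Hom init a)
  weak_fin : ∀ a : V, a ≠ fin → Nonempty (Hom a fin)
  /-- the maximal arrow -/
  maxArrow : Hom init fin
  eq_maxArrow : ∀ f : Hom init fin, f = maxArrow
  nontrivial : ∃ a : V, a ≠ init ∧ a ≠ fin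

variable {V : Type u}

/-- Initial data: a functor from the lattice `Γ` to `ho 𝒯_*`. -/
structure InitialData (Γ : DiagramLattice.{u, v} V) where
  obj : V → PtSpace.{w}
  map : ∀ {a b : V}, Γ.Hom a b → HoMap (obj a) (obj b)
  map_comp : ∀ {a b c : V} (g : Γ.Hom b c) (f : Γ.Hom a b), map (Γ.comp g f) = (map g).comp (map f)

/-! ### The `W`-construction -/

/-- Nonempty chains of composable arrows of `Γ`; `cons f c` is the chain `c` followed by `f`. -/
inductive Chain (Γ : DiagramLattice.{u, v} V) : V → V → Type (max u v)
  | single {a b : V} (f : Γ.Hom a b) : Chain Γ a b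
  | cons {a b c : V} (f : Γ.Hom b c) (l : Chain Γ a b) : Chain Γ a c

/-- The number of internal nodes of a chain (`n` for an `(n+1)`-chain). -/
def Chain.inner {Γ : DiagramLattice.{u, v} V} {a b : V} : Chain Γ a b → ℕ
  | .single _ => 0
  | .cons _ l => l.inner + 1

/-- The disjoint union, over all chains `c` from `a` to `b`, of the cubes `Iⁿ`, where `n` is the
number of internal nodes of `c`. A point is written `f₁ ∘_{t₁} f₂ ∘_{t₂} ⋯ ∘_{tₙ} fₙ₊₁`, where
`f₁` is the last arrow of the chain. It carries the disjoint union topology. -/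
abbrev Pre (Γ : DiagramLattice.{u, v} V) (a b : V) : Type (max u v) :=
  Σ c : Chain Γ a b, (Fin c.inner → I)

/-- The point `f` of the zero-dimensional cube of the `1`-chain `f`. -/
def Pre.of {Γ : DiagramLattice.{u, v} V} {a b : V} (f : Γ.Hom a b) : Pre Γ a b :=
  ⟨.single f, Fin.elim0⟩

/-- The point `f ∘_t p`. -/
def Pre.cons {Γ : DiagramLattice.{u, v} V} {a b c : V} (f : Γ.Hom b c) (t : I) (p : Pre Γ a b) :
    Pre Γ a c :=
  ⟨.cons f p.1, Fin.cons t p.2⟩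

/-- The relation that replaces one occurrence of `f ∘_0 g` in a point by the composite `f g`. -/
inductive Face (Γ : DiagramLattice.{u, v} V) : ∀ {a b : V}, Pre Γ a b → Pre Γ a b → Prop
  | last {a b c : V} (f : Γ.Hom b c) (g : Γ.Hom a b) :
      Face Γ (Pre.cons f 0 (Pre.of g)) (Pre.of (Γ.comp f g))
  | head {a b c d : V} (f : Γ.Hom c d) (g : Γ.Hom b c) (t : I) (p : Pre Γ a b) :
      Face Γ (Pre.cons f 0 (Pre.cons g t p)) (Pre.cons (Γ.comp f g) t p)
  | tail {a b c : V} (f : Γ.Hom b c) (t : I) {p q : Pre Γ a b} :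
      Face Γ p q → Face Γ (Pre.cons f t p) (Pre.cons f t q)

/-- The space of morphisms `WΓ(a, b)`: the quotient of the disjoint union of cubes by the
equivalence relation generated by `Face`, with the quotient topology. -/
def W (Γ : DiagramLattice.{u, v} V) (a b : V) : Type (max u v) :=
  Quot (@Face V Γ a b)

instance (Γ : DiagramLattice.{u, v} V) (a b : V) : TopologicalSpace (W Γ a b) :=
  inferInstanceAs (TopologicalSpace (Quot (@Face V Γ a b)))

/-- The class of a point in `WΓ(a, b)`. -/
def W.mk {Γ : DiagramLattice.{u, v} V} {a b : V} (p : Pre Γ a b) : W Γ a b := Quot.mk _ p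

/-- The inclusion `σ` of the arrows of `Γ` into those of `WΓ`. -/
def W.ofArrow {Γ : DiagramLattice.{u, v} V} {a b : V} (f : Γ.Hom a b) : W Γ a b := W.mk (Pre.of f)

/-- Auxiliary recursion for `Pre.append`. -/
def Pre.appendAux {Γ : DiagramLattice.{u, v} V} {a b c : V} (q : Pre Γ a b) :
    (l : Chain Γ b c) → (Fin l.inner → I) → Pre Γ a c
  | .single f, _ => Pre.cons f 1 q
  | .cons f l, t => Pre.cons f (t (0 : Fin (l.inner + 1)))
      (Pre.appendAux q l (Fin.tail (n := l.inner) t))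

/-- Concatenation `p ∘_1 q`. -/
def Pre.append {Γ : DiagramLattice.{u, v} V} {a b c : V} (p : Pre Γ b c) (q : Pre Γ a b) :
    Pre Γ a c :=
  Pre.appendAux q p.1 p.2

section
variable {Γ : DiagramLattice.{u, v} V}

theorem Pre.of_append {a b c : V} (f : Γ.Hom b c) (q : Pre Γ a b) :
    (Pre.of f).append q = Pre.cons f 1 q := rfl

theorem Pre.cons_append {a b c d : V} (f : Γ.Hom c d) (t : I) (p : Pre Γ b c) (q : Pre Γ a b) :
    (Pre.cons f t p).append q = Pre.cons f t (p.append q) := rfl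

theorem Pre.rec_on {motive : ∀ {a b : V}, Pre Γ a b → Prop}
    (of : ∀ {a b : V} (f : Γ.Hom a b), motive (Pre.of f))
    (cons : ∀ {a b c : V} (f : Γ.Hom b c) (t : I) (p : Pre Γ a b), motive p →
      motive (Pre.cons f t p)) {a b : V} (p : Pre Γ a b) : motive p := by
  obtain ⟨l, t⟩ := p
  induction l with
  | single f =>
    have e : t = Fin.elim0 := funext fun i => Fin.elim0 i
    rw [e]
    exact of f
  | cons f l ih =>
    change Fin (l.inner + 1) → I at t
    have e : Pre.cons f (t 0) ⟨l, Fin.tail t⟩ = ⟨.cons f l, t⟩ :=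
      congrArg (Sigma.mk (Chain.cons f l)) (Fin.cons_self_tail t)
    exact e ▸ cons f (t 0) ⟨l, Fin.tail t⟩ (ih _)

theorem Face.append_left {a b c : V} {p p' : Pre Γ b c} (h : Face Γ p p') (q : Pre Γ a b) :
    Face Γ (p.append q) (p'.append q) := by
  induction h with
  | last f g => exact .head f g 1 q
  | head f g t p => exact .head f g t (p.append q)
  | tail f t _ ih => exact .tail f t ih

theorem Face.append_right {a b c : V} (p : Pre Γ b c) {q q' : Pre Γ a b} (h : Face Γ q q') :
    Face Γ (p.append q) (p.append q') := by
  induction p using Pre.rec_on with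
  | of f => exact .tail f 1 h
  | cons f t p ih => exact .tail f t (ih h)

end

/-- Composition in `WΓ`, given by concatenation. -/
def W.comp {Γ : DiagramLattice.{u, v} V} {a b c : V} (x : W Γ b c) (y : W Γ a b) : W Γ a c :=
  Quot.map₂ Pre.append (fun p _ _ h => h.append_right p) (fun _ _ q h => h.append_left q) x y

theorem W.assoc {Γ : DiagramLattice.{u, v} V} {a b c d : V} (x : W Γ c d) (y : W Γ b c)
    (z : W Γ a b) : (x.comp y).comp z = x.comp (y.comp z) := by
  induction x using Quot.ind with | _ p
  induction y using Quot.ind with | _ q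
  induction z using Quot.ind with | _ r
  refine congrArg (Quot.mk _) ?_
  induction p using Pre.rec_on with
  | of f => rfl
  | cons f t p ih => exact congrArg (Pre.cons f t) (ih q)

/-! ### Subcategories of `WΓ` -/

/-- A (nonunital) subcategory of `WΓ` with all the nodes as objects. -/
structure Subcat (Γ : DiagramLattice.{u, v} V) where
  mor : ∀ a b : V, Set (W Γ a b)
  comp_mem : ∀ {a b c : V} {x : W Γ b c} {y : W Γ a b},
    x ∈ mor b c → y ∈ mor a b → x.comp y ∈ mor a c

/-- `WΓ` itself. -/
def Subcat.whole (Γ : DiagramLattice.{u, v} V) : Subcat Γ where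
  mor _ _ := Set.univ
  comp_mem _ _ := trivial

theorem Chain.ne {Γ : DiagramLattice.{u, v} V} {a b : V} (l : Chain Γ a b) : a ≠ b := by
  have h : Nonempty (Γ.Hom a b) := by
    induction l with
    | single f => exact ⟨f⟩
    | cons f _ ih => exact ⟨Γ.comp f ih.some⟩
  rintro rfl
  exact (Γ.directed a).false h.some

theorem W.ne {Γ : DiagramLattice.{u, v} V} {a b : V} (x : W Γ a b) : a ≠ b := by
  induction x using Quot.ind with | _ p
  exact p.1.ne

/-- The subcategory `bWΓ`: all morphisms of `WΓ`, except that from `init` to `fin` only those are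
kept that decompose through some other node. -/
def Subcat.basis (Γ : DiagramLattice.{u, v} V) : Subcat Γ where
  mor a b := {x | a = Γ.init → b = Γ.fin →
    ∃ (c : V) (y : W Γ c b) (z : W Γ a c), c ≠ Γ.init ∧ c ≠ Γ.fin ∧ x = y.comp z}
  comp_mem {a c b x y} _ _ := by
    intro ha hb
    exact ⟨c, x, y, fun h => y.ne (ha.trans h.symm), fun h => x.ne (h.trans hb.symm), rfl⟩

/-- The face of the cube `C[c]` in which the coordinates in `S` are free and every other coordinate
`i` has the fixed value `e i`. -/
def face {Γ : DiagramLattice.{u, v} V} {a b : V} (c : Chain Γ a b) (S : Finset (Fin c.inner))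
    (e : Fin c.inner → I) : Set (W Γ a b) :=
  {x | ∃ t : Fin c.inner → I, (∀ i ∉ S, t i = e i) ∧ x = W.mk ⟨c, t⟩}

/-- Membership in the subcategory generated by all those faces of dimension at most `k` of cubes
of `WΓ` that lie in `U`. -/
inductive SkMem {Γ : DiagramLattice.{u, v} V} (k : ℕ) (U : Subcat Γ) :
    ∀ {a b : V}, W Γ a b → Prop
  | face {a b : V} (c : Chain Γ a b) (S : Finset (Fin c.inner)) (e : Fin c.inner → I)
      (he : ∀ i ∉ S, e i = 0 ∨ e i = 1) (hS : S.card ≤ k) (hU : face c S e ⊆ U.mor a b)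
      (x : W Γ a b) (hx : x ∈ face c S e) : SkMem k U x
  | comp {a b c : V} (x : W Γ b c) (y : W Γ a b) :
      SkMem k U x → SkMem k U y → SkMem k U (x.comp y)

/-- The `k`-skeleton of a cubical subcategory `U` of `WΓ`. -/
def Subcat.sk {Γ : DiagramLattice.{u, v} V} (k : ℕ) (U : Subcat Γ) : Subcat Γ where
  mor _ _ := {x | SkMem k U x}
  comp_mem hx hy := .comp _ _ hx hy

/-- Every arrow of `Γ` other than the maximal one belongs to every skeleton of `bWΓ`. -/
theorem ofArrow_mem_sk_basis {Γ : DiagramLattice.{u, v} V} (k : ℕ) {a b : V} (f : Γ.Hom a b)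
    (h : ¬(a = Γ.init ∧ b = Γ.fin)) : W.ofArrow f ∈ ((Subcat.basis Γ).sk k).mor a b :=
  SkMem.face (U := Subcat.basis Γ) (.single f) ∅ Fin.elim0 (fun i => i.elim0) (Nat.zero_le k)
    (by intro x _ ha hb; exact absurd ⟨ha, hb⟩ h) _ ⟨Fin.elim0, fun i => i.elim0, rfl⟩

/-! ### Functors to spaces and realizations -/

/-- A continuous functor `U → 𝒯_*` which on objects is the given family `X`. Continuity of
`U(a, b) → 𝒯_*(X a, X b)` is expressed through the adjoint map `U(a, b) × X a → X b`. -/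
structure SpaceFunctor {Γ : DiagramLattice.{u, v} V} (U : Subcat Γ) (X : V → PtSpace.{w}) where
  map : ∀ {a b : V}, U.mor a b → PtMap (X a) (X b)
  map_comp : ∀ {a b c : V} (x : U.mor b c) (y : U.mor a b),
    map ⟨x.1.comp y.1, U.comp_mem x.2 y.2⟩ = (map x).comp (map y)
  continuous_map : ∀ a b : V, Continuous fun p : U.mor a b × X a => (map p.1).toMap p.2

/-- `F` is an `n`-realization of the initial data `A`: a functor `sk_n bWΓ → 𝒯_*` with the same
objects as `A`, such that `[F(f)] = A(f)` for every arrow `f` of `Γ` except the maximal one, which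
is the only arrow from `init` to `fin`. -/
def IsRealization {Γ : DiagramLattice.{u, v} V} (n : ℕ) (A : InitialData.{u, v, w} Γ)
    (F : SpaceFunctor ((Subcat.basis Γ).sk n) A.obj) : Prop :=
  ∀ (a b : V) (f : Γ.Hom a b) (h : ¬(a = Γ.init ∧ b = Γ.fin)),
    (F.map ⟨W.ofArrow f, ofArrow_mem_sk_basis n f h⟩).cls = A.map f

/-- The functor `B : WΓ → 𝒯_*` extends the functor `F : U → 𝒯_*`. -/
def Extends {Γ : DiagramLattice.{u, v} V} {U : Subcat Γ} {X : V → PtSpace.{w}}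
    (B : SpaceFunctor (Subcat.whole Γ) X) (F : SpaceFunctor U X) : Prop :=
  ∀ (a b : V) (x : U.mor a b), B.map ⟨x.1, trivial⟩ = F.map x

end HigherOps

/-!
Let `B` be a functor on `WΓ` and suppose that each value `B f` at an arrow of `Γ` is pointed
homotopic to a map `g f`, by a homotopy `H f`. To deform `B` to a functor with the values `g f`, cut
a point of `WΓ` at its parameters `t ≥ 2/3`, and for each of the resulting segments let `d` be the
largest of the parameters inside it and of the defects `1 - t` of the cuts at its ends. A segment
with `d ≥ 1/3` acts by `B`, after a reparametrization that sends `[0, 1/3]` to `0` and `[2/3, 1]` to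
`1`; if `d ≤ 1/3`, this reparametrized segment is the composite `f` of its arrows, and the segment
acts by `H f` at the time `1 - 3d` instead. Where a cut appears, at `t = 2/3`, both segments next
to it and their concatenation have `d ≥ 1/3`, so that the result is continuous. A parameter `1`
gives a cut without defect, whence functoriality, and at an arrow of `Γ` we have `d = 0` and the
value `g f`.

Since the vertices of `bWΓ` are composites of arrows other than the maximal one, this gives the
theorem. Continuity is checked on the cubes, because the projection from them to `WΓ(a, b)` is a
proper map and so remains a quotient map after taking the product with any space.
-/

namespace HigherOps

open unitInterval

variable {V : Type u} {Γ : DiagramLattice.{u, v} V}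

/-! ### Points of the cubes -/

theorem continuous_sigma_prod {ι : Type*} {E : ι → Type*} [∀ i, TopologicalSpace (E i)]
    {Y Z : Type*} [TopologicalSpace Y] [TopologicalSpace Z] {f : (Σ i, E i) × Y → Z}
    (h : ∀ i, Continuous fun q : E i × Y => f (⟨i, q.1⟩, q.2)) : Continuous f :=
  (Homeomorph.sigmaProdDistrib (X := E) (Y := Y)).symm.comp_continuous_iff'.1 (continuous_sigma h)

/-- Auxiliary recursion for `Pre.fold`. -/
def Chain.fold {a : V} {C : V → Sort*} (of : ∀ ⦃b⦄, Γ.Hom a b → C b)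
    (cons : ∀ ⦃b c⦄, Γ.Hom b c → I → C b → C c) {b : V} :
    (l : Chain Γ a b) → (Fin l.inner → I) → C b
  | .single f, _ => of f
  | .cons f l, t => cons f (t (0 : Fin (l.inner + 1)))
      (l.fold of cons (Fin.tail (n := l.inner) t))

/-- Recursion on points with a fixed source: `of f` is the value at `f`, and `cons f t y` the value
at `f ∘_t p` if `y` is the value at `p`. -/
def Pre.fold {a : V} {C : V → Sort*} (of : ∀ ⦃b⦄, Γ.Hom a b → C b)
    (cons : ∀ ⦃b c⦄, Γ.Hom b c → I → C b → C c) {b : V} (p : Pre Γ a b) : C b :=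
  p.1.fold of cons p.2

theorem Pre.continuous_mk {a b : V} (l : Chain Γ a b) :
    Continuous fun t : Fin l.inner → I => (⟨l, t⟩ : Pre Γ a b) :=
  @continuous_sigmaMk _ (fun l : Chain Γ a b => Fin l.inner → I) _ l

theorem Pre.continuous_cons {a b c : V} (f : Γ.Hom b c) :
    Continuous fun q : I × Pre Γ a b => Pre.cons f q.1 q.2 :=
  Continuous.comp (g := fun q : Pre Γ a b × I => Pre.cons f q.2 q.1)
    (continuous_sigma_prod fun l => (Pre.continuous_mk (.cons f l)).comp
      (Continuous.finCons (A := fun _ => I) continuous_snd continuous_fst))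
    continuous_swap

/-- The concatenation `p ∘_s q`. -/
def Pre.glue {a b c : V} (p : Pre Γ b c) (s : I) (q : Pre Γ a b) : Pre Γ a c :=
  p.fold (C := Pre Γ a) (fun _ f => Pre.cons f s q) fun _ _ f t r => Pre.cons f t r

theorem Pre.of_glue {a b c : V} (f : Γ.Hom b c) (s : I) (q : Pre Γ a b) :
    (Pre.of f).glue s q = Pre.cons f s q := rfl

theorem Pre.cons_glue {a b c d : V} (f : Γ.Hom c d) (t : I) (p : Pre Γ b c) (s : I)
    (q : Pre Γ a b) : (Pre.cons f t p).glue s q = Pre.cons f t (p.glue s q) := rfl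

theorem Pre.glue_one {a b c : V} (p : Pre Γ b c) (q : Pre Γ a b) : p.glue 1 q = p.append q := by
  induction p using Pre.rec_on with
  | of f => rfl
  | cons f t p ih => exact congrArg (Pre.cons f t) (ih q)

/-- The largest parameter of a point, and `0` for an arrow. -/
def Pre.maxParam {a b : V} (p : Pre Γ a b) : I := Finset.univ.sup p.2

theorem Pre.le_maxParam {a b : V} (p : Pre Γ a b) (i : Fin p.1.inner) : p.2 i ≤ p.maxParam :=
  Finset.le_sup (Finset.mem_univ i)

theorem Pre.continuous_maxParam {a b : V} : Continuous (Pre.maxParam : Pre Γ a b → I) :=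
  continuous_sigma fun l => Continuous.finset_sup_apply (s := Finset.univ)
    (f := fun i (t : Fin l.inner → I) => t i) fun i _ => continuous_apply i

theorem Pre.maxParam_cons {a b c : V} (f : Γ.Hom b c) (t : I) (p : Pre Γ a b) :
    (Pre.cons f t p).maxParam = t ⊔ p.maxParam := by
  change (Finset.univ : Finset (Fin (p.1.inner + 1))).sup (Fin.cons t p.2) = t ⊔ _
  rw [Fin.univ_succ, Finset.sup_cons, Finset.sup_map]
  rfl

theorem Pre.le_maxParam_glue {a b c : V} (p : Pre Γ b c) (s : I) (q : Pre Γ a b) :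
    s ≤ (p.glue s q).maxParam := by
  induction p using Pre.rec_on with
  | of f => exact le_sup_left.trans_eq (Pre.maxParam_cons f s q).symm
  | cons f t p ih => exact ((ih q).trans le_sup_right).trans_eq (Pre.maxParam_cons f t _).symm

theorem Face.maxParam_eq {a b : V} {p q : Pre Γ a b} (h : Face Γ p q) :
    p.maxParam = q.maxParam := by
  induction h with
  | last f g => exact (Pre.maxParam_cons f 0 _).trans (bot_sup_eq _)
  | head f g t p => simp only [Pre.maxParam_cons, sup_of_le_right, unitInterval.nonneg']
  | tail f t _ ih => rw [Pre.maxParam_cons, ih, Pre.maxParam_cons]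

/-- The reparametrization of a point that applies `φ` to each of its parameters. -/
def Pre.map {a b : V} (φ : I → I) (p : Pre Γ a b) : Pre Γ a b := ⟨p.1, φ ∘ p.2⟩

theorem Pre.continuous_map {a b : V} {φ : I → I} (hφ : Continuous φ) :
    Continuous (Pre.map φ : Pre Γ a b → Pre Γ a b) :=
  continuous_sigma fun l => (Pre.continuous_mk l).comp
    (continuous_pi fun i => hφ.comp (continuous_apply i))

theorem Pre.map_of {a b : V} (φ : I → I) (f : Γ.Hom a b) : (Pre.of f).map φ = Pre.of f :=
  congrArg (Sigma.mk (Chain.single f)) (funext fun i => Fin.elim0 i)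

theorem Pre.map_cons {a b c : V} (φ : I → I) (f : Γ.Hom b c) (t : I) (p : Pre Γ a b) :
    (Pre.cons f t p).map φ = Pre.cons f (φ t) (p.map φ) :=
  congrArg (Sigma.mk (Chain.cons f p.1)) (Fin.comp_cons φ t p.2)

theorem Pre.map_glue {a b c : V} (φ : I → I) (p : Pre Γ b c) (s : I) (q : Pre Γ a b) :
    (p.glue s q).map φ = (p.map φ).glue (φ s) (q.map φ) := by
  induction p using Pre.rec_on with
  | of f => rw [Pre.of_glue, Pre.map_cons, Pre.map_of, Pre.of_glue]
  | cons f t p ih => rw [Pre.cons_glue, Pre.map_cons, ih, Pre.map_cons, Pre.cons_glue]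

theorem Face.map {a b : V} {φ : I → I} (hφ : φ 0 = 0) {p q : Pre Γ a b} (h : Face Γ p q) :
    Face Γ (p.map φ) (q.map φ) := by
  induction h with
  | last f g =>
    simp only [Pre.map_cons, Pre.map_of, hφ]
    exact .last f g
  | head f g t p =>
    simp only [Pre.map_cons, hφ]
    exact .head f g _ _
  | tail f t _ ih =>
    simp only [Pre.map_cons]
    exact .tail f _ ih

/-- The composite in `Γ` of all the arrows of a chain. -/
def Chain.total {a b : V} : Chain Γ a b → Γ.Hom a b
  | .single f => f
  | .cons f l => Γ.comp f l.total

theorem Face.total_eq {a b : V} {p q : Pre Γ a b} (h : Face Γ p q) : p.1.total = q.1.total := by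
  induction h with
  | last f g => rfl
  | head f g _ p => exact (Γ.assoc f g p.1.total).symm
  | tail f _ _ ih => exact congrArg (Γ.comp f) ih

theorem W.mk_eq {a b : V} {p q : Pre Γ a b} (h : Face Γ p q) : W.mk p = W.mk q := Quot.sound h

/-- The operation `x ↦ f ∘_t x` on morphisms of `WΓ`. -/
def W.cons {a b c : V} (f : Γ.Hom b c) (t : I) : W Γ a b → W Γ a c :=
  Quot.map (Pre.cons f t) fun _ _ h => .tail f t h

theorem W.mk_cons {a b c : V} (f : Γ.Hom b c) (t : I) (p : Pre Γ a b) :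
    W.mk (Pre.cons f t p) = W.cons f t (W.mk p) := rfl

theorem W.mk_eq_ofArrow_total {a b : V} {p : Pre Γ a b} (hp : ∀ i, p.2 i = 0) :
    W.mk p = W.ofArrow p.1.total := by
  induction p using Pre.rec_on with
  | of f => rfl
  | cons f t p ih =>
    obtain rfl : t = 0 := hp (0 : Fin (p.1.inner + 1))
    rw [W.mk_cons, ih fun i => hp i.succ]
    exact W.mk_eq (.last f p.1.total)

/-! ### Properness of the projection from the cubes -/

instance Chain.finite (a b : V) : Finite (Chain Γ a b) := by
  have := Γ.finite_nodes
  have := Γ.finite_hom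
  let r : V → V → Prop := fun x y => Nonempty (Γ.Hom x y)
  have : IsTrans V r := ⟨fun _ _ _ ⟨f⟩ ⟨g⟩ => ⟨Γ.comp g f⟩⟩
  have : Std.Irrefl r := ⟨fun x ⟨f⟩ => (Γ.directed x).false f⟩
  induction b using (Finite.wellFounded_of_trans_of_irrefl r).induction with
  | _ b ih =>
    have (c : V) : Finite (Γ.Hom c b × Chain Γ a c) := by
      rcases isEmpty_or_nonempty (Γ.Hom c b) with h | h
      · infer_instance
      · have := ih c h
        infer_instance
    let ofSum : Γ.Hom a b ⊕ (Σ c, Γ.Hom c b × Chain Γ a c) → Chain Γ a b :=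
      Sum.elim .single fun q => .cons q.2.1 q.2.2
    refine Finite.of_surjective ofSum fun l => ?_
    cases l with
    | single f => exact ⟨.inl f, rfl⟩
    | cons f l => exact ⟨.inr ⟨_, f, l⟩, rfl⟩

/-- The point `f ∘_0 p`, with the first two arrows composed. -/
def Pre.merge {a b c : V} (f : Γ.Hom b c) : Pre Γ a b → Pre Γ a c
  | ⟨.single g, _⟩ => Pre.of (Γ.comp f g)
  | ⟨.cons g l, t⟩ => ⟨.cons (Γ.comp f g) l, t⟩

theorem Pre.continuous_merge {a b c : V} (f : Γ.Hom b c) :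
    Continuous (Pre.merge f : Pre Γ a b → Pre Γ a c) := by
  refine continuous_sigma fun l => ?_
  cases l with
  | single g => exact continuous_const
  | cons g l => exact Pre.continuous_mk (.cons (Γ.comp f g) l)

theorem Face.cons_zero_merge {a b c : V} (f : Γ.Hom b c) (p : Pre Γ a b) :
    Face Γ (Pre.cons f 0 p) (Pre.merge f p) := by
  induction p using Pre.rec_on with
  | of g => exact .last f g
  | cons g t p => exact .head f g t p

theorem Pre.merge_merge {a b c d : V} (f : Γ.Hom c d) (g : Γ.Hom b c) (p : Pre Γ a b) :
    Pre.merge f (Pre.merge g p) = Pre.merge (Γ.comp f g) p := by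
  rcases p with ⟨_ | ⟨h, l⟩, t⟩
  · exact congrArg Pre.of (Γ.assoc f g _).symm
  · exact congrArg (fun k => (⟨.cons k l, t⟩ : Pre Γ a d)) (Γ.assoc f g h).symm

open Classical in
/-- The point obtained from a chain with parameters by composing the two arrows at each of the
joints in `S` and keeping the parameters at the others. -/
noncomputable def Chain.contract {a b : V} :
    (l : Chain Γ a b) → (S : Fin l.inner → Prop) → (Fin l.inner → I) → Pre Γ a b
  | .single f, _, _ => Pre.of f
  | .cons f l, S, t =>
    let r := l.contract (Fin.tail (n := l.inner) S) (Fin.tail (n := l.inner) t)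
    if S (0 : Fin (l.inner + 1)) then Pre.merge f r
    else Pre.cons f (t (0 : Fin (l.inner + 1))) r

theorem Chain.continuous_contract {a b : V} (l : Chain Γ a b) (S : Fin l.inner → Prop) :
    Continuous (l.contract S) := by
  induction l with
  | single f => exact continuous_const
  | cons f l ih =>
    have hr := (ih (Fin.tail (n := l.inner) S)).comp
      (Continuous.finTail (n := l.inner) (A := fun _ => I) continuous_id)
    by_cases h : S (0 : Fin (l.inner + 1))
    · exact ((Pre.continuous_merge f).comp hr).congr fun t => (if_pos h).symm
    · exact ((Pre.continuous_cons f).comp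
        ((continuous_apply (0 : Fin (l.inner + 1))).prodMk hr)).congr fun t => (if_neg h).symm

/-- The point obtained from a point by composing the two arrows at each of the joints in `S`. -/
noncomputable def Pre.contract {a b : V} (p : Pre Γ a b) (S : Fin p.1.inner → Prop) : Pre Γ a b :=
  p.1.contract S p.2

theorem Pre.contract_cons_of_mem {a b c : V} (f : Γ.Hom b c) (t : I) (p : Pre Γ a b)
    {S : Fin (p.1.inner + 1) → Prop} (h : S 0) :
    (Pre.cons f t p).contract S = Pre.merge f (p.contract (Fin.tail S)) :=
  if_pos h

theorem Pre.contract_cons_of_notMem {a b c : V} (f : Γ.Hom b c) (t : I) (p : Pre Γ a b)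
    {S : Fin (p.1.inner + 1) → Prop} (h : ¬S 0) :
    (Pre.cons f t p).contract S = Pre.cons f t (p.contract (Fin.tail S)) :=
  if_neg h

theorem W.mk_contract {a b : V} (p : Pre Γ a b) {S : Fin p.1.inner → Prop}
    (hS : ∀ i, S i → p.2 i = 0) : W.mk (p.contract S) = W.mk p := by
  induction p using Pre.rec_on with
  | of f => rfl
  | cons f t p ih =>
    have ih : W.mk (p.contract (Fin.tail S)) = W.mk p := ih fun i => hS i.succ
    by_cases h : S (0 : Fin (p.1.inner + 1))
    · obtain rfl : t = 0 := hS (0 : Fin (p.1.inner + 1)) h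
      rw [Pre.contract_cons_of_mem f 0 p h, ← W.mk_eq (.cons_zero_merge f _), W.mk_cons, ih,
        W.mk_cons]
    · rw [Pre.contract_cons_of_notMem f t p h, W.mk_cons, ih, W.mk_cons]

/-- The representative without zero parameters of the class of a point. -/
noncomputable def Pre.nf {a b : V} (p : Pre Γ a b) : Pre Γ a b :=
  p.contract fun i => p.2 i = 0

theorem Pre.nf_cons_zero {a b c : V} (f : Γ.Hom b c) (p : Pre Γ a b) :
    (Pre.cons f 0 p).nf = Pre.merge f p.nf :=
  if_pos rfl

theorem Pre.nf_cons_of_ne {a b c : V} (f : Γ.Hom b c) {t : I} (ht : t ≠ 0) (p : Pre Γ a b) :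
    (Pre.cons f t p).nf = Pre.cons f t p.nf :=
  if_neg ht

theorem Face.nf_eq {a b : V} {p q : Pre Γ a b} (h : Face Γ p q) : p.nf = q.nf := by
  induction h with
  | last f g => exact Pre.nf_cons_zero f (Pre.of g)
  | head f g t p =>
    rw [Pre.nf_cons_zero]
    by_cases ht : t = 0
    · rw [ht, Pre.nf_cons_zero, Pre.nf_cons_zero, Pre.merge_merge]
    · rw [Pre.nf_cons_of_ne g ht, Pre.nf_cons_of_ne _ ht]
      rfl
  | tail f t _ ih =>
    by_cases ht : t = 0
    · rw [ht, Pre.nf_cons_zero, Pre.nf_cons_zero, ih]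
    · rw [Pre.nf_cons_of_ne f ht, Pre.nf_cons_of_ne f ht, ih]

theorem W.mk_eq_mk_iff_exists_contract {a b : V} {p q : Pre Γ a b} :
    W.mk p = W.mk q ↔ ∃ S T, ((∀ i, S i → p.2 i = 0) ∧ ∀ i, T i → q.2 i = 0) ∧
      p.contract S = q.contract T := by
  constructor
  · intro h
    exact ⟨_, _, ⟨fun _ => id, fun _ => id⟩,
      congrArg (Quot.lift Pre.nf fun _ _ => Face.nf_eq) h⟩
  · rintro ⟨S, T, ⟨hS, hT⟩, h⟩
    rw [← W.mk_contract p hS, h, W.mk_contract q hT]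

theorem W.isClosed_setOf_mk_eq_mk {a b : V} :
    IsClosed {r : Pre Γ a b × Pre Γ a b | W.mk r.1 = W.mk r.2} := by
  let K (l l' : Chain Γ a b) (S : Fin l.inner → Prop) (T : Fin l'.inner → Prop) :
      Set ((Fin l.inner → I) × (Fin l'.inner → I)) :=
    {r | ((∀ i, S i → r.1 i = 0) ∧ ∀ i, T i → r.2 i = 0) ∧ l.contract S r.1 = l'.contract T r.2}
  have hK (l l' S T) : IsClosed (K l l' S T) := by
    refine (IsClosed.and ?_ ?_).and (isClosed_eq
      ((l.continuous_contract S).comp continuous_fst)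
      ((l'.continuous_contract T).comp continuous_snd))
    all_goals
      simp only [Set.ofPred_forall]
      exact isClosed_iInter fun i => isClosed_iInter fun _ =>
        isClosed_eq (by fun_prop) (by fun_prop)
  have hR : {r : Pre Γ a b × Pre Γ a b | W.mk r.1 = W.mk r.2} =
      ⋃ (l) (l') (S) (T), Prod.map (Sigma.mk l) (Sigma.mk l') '' K l l' S T := by
    ext ⟨⟨l, s⟩, ⟨l', t⟩⟩
    simp only [Set.mem_iUnion]
    refine W.mk_eq_mk_iff_exists_contract.trans ⟨?_, ?_⟩
    · rintro ⟨S, T, h⟩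
      exact ⟨l, l', S, T, (s, t), h, rfl⟩
    · rintro ⟨_, _, S, T, _, h, ⟨⟩⟩
      exact ⟨S, T, h⟩
  rw [hR]
  refine isClosed_iUnion_of_finite fun l => isClosed_iUnion_of_finite fun l' =>
    isClosed_iUnion_of_finite fun S => isClosed_iUnion_of_finite fun T => ?_
  exact ((hK l l' S T).isCompact.image
    ((Pre.continuous_mk l).prodMap (Pre.continuous_mk l'))).isClosed

theorem W.isQuotientMap_mk {a b : V} : Topology.IsQuotientMap (W.mk : Pre Γ a b → W Γ a b) :=
  isQuotientMap_quot_mk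

theorem W.isClosedMap_mk {a b : V} : IsClosedMap (W.mk : Pre Γ a b → W Γ a b) := by
  intro s hs
  have hsat : W.mk ⁻¹' (W.mk '' s) =
      Prod.snd '' ({r : Pre Γ a b × Pre Γ a b | W.mk r.1 = W.mk r.2} ∩ Prod.fst ⁻¹' s) := by
    ext q
    simp [and_comm]
  rw [← W.isQuotientMap_mk.isClosed_preimage, hsat]
  exact isClosedMap_snd_of_compactSpace _
    (W.isClosed_setOf_mk_eq_mk.inter (hs.preimage continuous_fst))

theorem W.isProperMap_mk {a b : V} : IsProperMap (W.mk : Pre Γ a b → W Γ a b) := by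
  have hcont := (W.isQuotientMap_mk (Γ := Γ) (a := a) (b := b)).continuous
  refine isProperMap_iff_isClosedMap_and_compact_fibers.2 ⟨hcont, W.isClosedMap_mk, fun x => ?_⟩
  obtain ⟨p, rfl⟩ := W.isQuotientMap_mk.surjective x
  have hp := W.isClosedMap_mk _ (isClosed_singleton (x := p))
  rw [Set.image_singleton] at hp
  exact (hp.preimage hcont).isCompact

theorem W.isQuotientMap_mk_prod {a b : V} (Y : Type*) [TopologicalSpace Y] :
    Topology.IsQuotientMap (Prod.map W.mk id : Pre Γ a b × Y → W Γ a b × Y) :=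
  (W.isProperMap_mk.prodMap isProperMap_id).isClosedMap.isQuotientMap
    (W.isQuotientMap_mk.continuous.prodMap continuous_id)
    (W.isQuotientMap_mk.surjective.prodMap Function.surjective_id)

/-! ### Deforming a functor along homotopies of the arrows -/

variable {X : V → PtSpace.{w}}

/-- The value of `B` at the class of a point. -/
def SpaceFunctor.app (B : SpaceFunctor (Subcat.whole Γ) X) {a b : V} (p : Pre Γ a b) :
    X a → X b :=
  (B.map ⟨W.mk p, trivial⟩).toMap

theorem SpaceFunctor.app_base (B : SpaceFunctor (Subcat.whole Γ) X) {a b : V} (p : Pre Γ a b) :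
    B.app p (X a).base = (X b).base :=
  (B.map ⟨W.mk p, trivial⟩).map_base

theorem SpaceFunctor.app_congr (B : SpaceFunctor (Subcat.whole Γ) X) {a b : V} {p q : Pre Γ a b}
    (h : W.mk p = W.mk q) : B.app p = B.app q := by
  simp only [SpaceFunctor.app, h]

theorem SpaceFunctor.app_append (B : SpaceFunctor (Subcat.whole Γ) X) {a b c : V}
    (p : Pre Γ b c) (q : Pre Γ a b) (x : X a) : B.app (p.append q) x = B.app p (B.app q x) :=
  congrArg (fun m : PtMap (X a) (X c) => m.toMap x)
    (B.map_comp ⟨W.mk p, trivial⟩ ⟨W.mk q, trivial⟩)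

theorem SpaceFunctor.continuous_app (B : SpaceFunctor (Subcat.whole Γ) X) (a b : V) :
    Continuous fun q : Pre Γ a b × X a => B.app q.1 q.2 :=
  (B.continuous_map a b).comp
    (((W.isQuotientMap_mk.continuous.comp continuous_fst).subtype_mk fun _ => trivial).prodMk
      continuous_snd)

/-- The functor on `WΓ` given by a family of maps on points that is compatible with faces and with
concatenation. -/
def SpaceFunctor.ofPre (Φ : ∀ ⦃a b : V⦄, Pre Γ a b → X a → X b)
    (hface : ∀ ⦃a b : V⦄ (p q : Pre Γ a b), Face Γ p q → Φ p = Φ q)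
    (happend : ∀ ⦃a b c : V⦄ (p : Pre Γ b c) (q : Pre Γ a b) (x : X a),
      Φ (p.append q) x = Φ p (Φ q x))
    (hbase : ∀ ⦃a b : V⦄ (p : Pre Γ a b), Φ p (X a).base = (X b).base)
    (hcont : ∀ a b : V, Continuous fun q : Pre Γ a b × X a => Φ q.1 q.2) :
    SpaceFunctor (Subcat.whole Γ) X :=
  have hlift (a b : V) :
      Continuous fun q : W Γ a b × X a => Quot.lift (@Φ a b) (@hface a b) q.1 q.2 :=
    (W.isQuotientMap_mk_prod (X a)).continuous_iff.2 (hcont a b)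
  { map := fun {a b} x =>
      { toMap := ⟨Quot.lift (@Φ a b) (@hface a b) x.1,
          (hlift a b).comp (continuous_const.prodMk continuous_id)⟩
        map_base := by
          obtain ⟨⟨p⟩, _⟩ := x
          exact hbase p }
    map_comp := by
      rintro a b c ⟨⟨p⟩, _⟩ ⟨⟨q⟩, _⟩
      ext x
      exact happend p q x
    continuous_map := fun a b =>
      (hlift a b).comp ((continuous_subtype_val.comp continuous_fst).prodMk continuous_snd) }

/-- Pointed homotopies from the values of `B` at the arrows of `Γ` to the maps `g`. -/
def ArrowHomotopy (B : SpaceFunctor (Subcat.whole Γ) X)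
    (g : ∀ ⦃a b : V⦄, Γ.Hom a b → PtMap (X a) (X b)) : Type (max u v w) :=
  ∀ ⦃a b : V⦄ (f : Γ.Hom a b), ContinuousMap.HomotopyRel
    (B.map ⟨W.ofArrow f, trivial⟩).toMap (g f).toMap {(X a).base}

/-- The map `I → I` that is `0` on `[0, 1/3]`, is `1` on `[2/3, 1]` and is linear in between. -/
noncomputable def stretch (t : I) : I := Set.projIcc 0 1 zero_le_one (3 * (t : ℝ) - 1)

theorem continuous_stretch : Continuous stretch :=
  continuous_projIcc.comp (by fun_prop)

theorem stretch_of_le {t : I} (ht : (t : ℝ) ≤ 1 / 3) : stretch t = 0 :=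
  Set.projIcc_of_le_left _ (by linarith)

theorem stretch_of_ge {t : I} (ht : 2 / 3 ≤ (t : ℝ)) : stretch t = 1 :=
  Set.projIcc_of_right_le _ (by linarith)

namespace ArrowHomotopy

variable {B : SpaceFunctor (Subcat.whole Γ) X} {g : ∀ ⦃a b : V⦄, Γ.Hom a b → PtMap (X a) (X b)}
  (H : ArrowHomotopy B g)

theorem apply_base {a b : V} (f : Γ.Hom a b) (s : I) : H f (s, (X a).base) = (X b).base :=
  ((H f).eq_fst s (Set.mem_singleton _)).trans (PtMap.map_base _)

/-- The value of the deformed functor at a point without cuts inside. The number `m` tells how far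
the cuts at its ends are from being complete; the point is complete where `m = 0`. -/
noncomputable def segment {a b : V} (p : Pre Γ a b) (m : I) (x : X a) : X b :=
  if (1 / 3 : ℝ) ≤ (p.maxParam ⊔ m : I) then B.app (p.map stretch) x
  else H p.1.total (Set.projIcc 0 1 zero_le_one (1 - 3 * ((p.maxParam ⊔ m : I) : ℝ)), x)

theorem app_map_stretch_eq {a b : V} (p : Pre Γ a b) {m : I}
    (h : ((p.maxParam ⊔ m : I) : ℝ) = 1 / 3) (x : X a) :
    B.app (p.map stretch) x =
      H p.1.total (Set.projIcc 0 1 zero_le_one (1 - 3 * ((p.maxParam ⊔ m : I) : ℝ)), x) := by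
  have hzero (i) : (p.map stretch).2 i = 0 :=
    stretch_of_le (h ▸ (p.le_maxParam i).trans le_sup_left)
  rw [Set.projIcc_of_le_left _ (by rw [h]; norm_num)]
  simp only [SpaceFunctor.app, W.mk_eq_ofArrow_total hzero]
  exact ((H p.1.total).apply_zero x).symm

theorem segment_of_le {a b : V} {p : Pre Γ a b} {m : I}
    (h : (1 / 3 : ℝ) ≤ (p.maxParam ⊔ m : I)) (x : X a) :
    H.segment p m x = B.app (p.map stretch) x :=
  if_pos h

theorem segment_of_zero {a b : V} (f : Γ.Hom a b) (x : X a) :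
    H.segment (Pre.of f) 0 x = (g f).toMap x := by
  have hmax : (Pre.of f).maxParam ⊔ 0 = 0 := sup_bot_eq _
  rw [segment, hmax, if_neg (by norm_num)]
  have htime : Set.projIcc (0 : ℝ) 1 zero_le_one (1 - 3 * ((0 : I) : ℝ)) = 1 :=
    Set.projIcc_of_right_le _ (by simp)
  rw [htime]
  exact (H f).apply_one x

theorem segment_congr {a b : V} {p q : Pre Γ a b} (h : Face Γ p q) : H.segment p = H.segment q := by
  funext m x
  have happ := B.app_congr (W.mk_eq (h.map (stretch_of_le (by simp))))
  rw [segment, segment, h.maxParam_eq, h.total_eq, happ]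

theorem segment_base {a b : V} (p : Pre Γ a b) (m : I) :
    H.segment p m (X a).base = (X b).base := by
  simp only [segment, B.app_base, H.apply_base, ite_self]

theorem continuous_segment (a b : V) :
    Continuous fun q : Pre Γ a b × I × X a => H.segment q.1 q.2.1 q.2.2 := by
  refine continuous_sigma_prod fun l => ?_
  let p (q : (Fin l.inner → I) × I × X a) : Pre Γ a b := ⟨l, q.1⟩
  have hp : Continuous p := (Pre.continuous_mk l).comp continuous_fst
  have hd : Continuous fun q => (((p q).maxParam ⊔ q.2.1 : I) : ℝ) :=
    continuous_subtype_val.comp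
      ((Pre.continuous_maxParam.comp hp).sup (continuous_fst.comp continuous_snd))
  have hx : Continuous fun q : (Fin l.inner → I) × I × X a => q.2.2 :=
    continuous_snd.comp continuous_snd
  refine Continuous.if_le
    ((B.continuous_app a b).comp (((Pre.continuous_map continuous_stretch).comp hp).prodMk hx))
    ((H l.total).continuous.comp ((continuous_projIcc.comp
      (continuous_const.sub (continuous_const.mul hd))).prodMk hx)) continuous_const hd ?_
  rintro ⟨t, m, x⟩ h
  exact H.app_map_stretch_eq ⟨l, t⟩ h.symm x

theorem segment_glue {a b c : V} (q : Pre Γ b c) {s : I} (hs : (s : ℝ) = 2 / 3) (y : Pre Γ a b)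
    (l r : I) (x : X a) :
    H.segment (q.glue s y) (l ⊔ r) x = H.segment q (l ⊔ σ s) (H.segment y (σ s ⊔ r) x) := by
  have hσ : (1 / 3 : ℝ) ≤ (σ s : I) := by rw [coe_symm_eq]; linarith
  have hmono {u v : I} (huv : u ≤ v) (hu : (1 / 3 : ℝ) ≤ u) : (1 / 3 : ℝ) ≤ v := hu.trans huv
  rw [H.segment_of_le (hmono ((q.le_maxParam_glue s y).trans le_sup_left) (by linarith)),
    H.segment_of_le (hmono (le_sup_right.trans le_sup_right) hσ),
    H.segment_of_le (hmono (le_sup_left.trans le_sup_right) hσ), Pre.map_glue,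
    stretch_of_ge hs.ge, Pre.glue_one, B.app_append]

/-- The type of interpretations of the segments that end at `b`, as maps to `X d`: the arguments are
a segment, the defect of the cut at its source, and a point of `X` there. -/
abbrev SegmentMap (Γ : DiagramLattice.{u, v} V) (X : V → PtSpace.{w}) (b d : V) :
    Type (max u v w) :=
  ∀ ⦃c : V⦄, Pre Γ c b → I → X c → X d

/-- The composite of the segments of `p`, which is cut at the parameters `t ≥ 2/3`: the segment at
the target end is interpreted by `k` and the other ones by `H.segment`. The cut at `t` has defect
`1 - t`. -/
noncomputable def eval {a b d : V} (p : Pre Γ a b) (k : SegmentMap Γ X b d) : X a → X d :=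
  p.fold (C := fun b => ∀ ⦃d : V⦄, SegmentMap Γ X b d → X a → X d)
    (fun _ f _ k => k (Pre.of f) 0)
    (fun _ _ f t y _ k x => if (2 / 3 : ℝ) ≤ t then
        k (Pre.of f) (σ t) (y (fun _ q r => H.segment q (σ t ⊔ r)) x)
      else y (fun _ q r => k (Pre.cons f t q) r) x) k

theorem eval_of {a b d : V} (f : Γ.Hom a b) (k : SegmentMap Γ X b d) :
    H.eval (Pre.of f) k = k (Pre.of f) 0 := rfl

theorem eval_cons_of_le {a b c d : V} (f : Γ.Hom b c) {t : I} (ht : (2 / 3 : ℝ) ≤ t)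
    (p : Pre Γ a b) (k : SegmentMap Γ X c d) (x : X a) :
    H.eval (Pre.cons f t p) k x =
      k (Pre.of f) (σ t) (H.eval p (fun _ q r => H.segment q (σ t ⊔ r)) x) :=
  if_pos ht

theorem eval_cons_of_not_le {a b c d : V} (f : Γ.Hom b c) {t : I} (ht : ¬(2 / 3 : ℝ) ≤ t)
    (p : Pre Γ a b) (k : SegmentMap Γ X c d) (x : X a) :
    H.eval (Pre.cons f t p) k x = H.eval p (fun _ q r => k (Pre.cons f t q) r) x :=
  if_neg ht

theorem apply_eval {a b d e : V} (φ : X d → X e) (p : Pre Γ a b) (k : SegmentMap Γ X b d)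
    (x : X a) : φ (H.eval p k x) = H.eval p (fun _ q r x => φ (k q r x)) x := by
  induction p using Pre.rec_on with
  | of f => rfl
  | cons f t p ih =>
    by_cases ht : (2 / 3 : ℝ) ≤ t
    · rw [H.eval_cons_of_le f ht, H.eval_cons_of_le f ht]
    · rw [H.eval_cons_of_not_le f ht, H.eval_cons_of_not_le f ht, ih]

theorem eval_append {a b c d : V} (p : Pre Γ b c) (q : Pre Γ a b) (k : SegmentMap Γ X c d)
    (x : X a) : H.eval (p.append q) k x = H.eval p k (H.eval q (fun _ => H.segment) x) := by
  induction p using Pre.rec_on generalizing d with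
  | of f =>
    have hone : (2 / 3 : ℝ) ≤ (1 : I) := by norm_num
    have hsup (r : I) : 0 ⊔ r = r := bot_sup_eq r
    simp only [Pre.of_append, H.eval_cons_of_le f hone, symm_one, hsup, H.eval_of]
  | cons f t p ih =>
    by_cases ht : (2 / 3 : ℝ) ≤ t
    · rw [Pre.cons_append, H.eval_cons_of_le f ht, ih, H.eval_cons_of_le f ht]
    · rw [Pre.cons_append, H.eval_cons_of_not_le f ht, ih, H.eval_cons_of_not_le f ht]

theorem eval_base {a b d : V} (p : Pre Γ a b) {k : SegmentMap Γ X b d}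
    (hk : ∀ ⦃c : V⦄ (q : Pre Γ c b) (r : I), k q r (X c).base = (X d).base) :
    H.eval p k (X a).base = (X d).base := by
  induction p using Pre.rec_on generalizing d with
  | of f => exact hk _ _
  | cons f t p ih =>
    by_cases ht : (2 / 3 : ℝ) ≤ t
    · rw [H.eval_cons_of_le f ht, ih fun _ q r => H.segment_base q _, hk]
    · rw [H.eval_cons_of_not_le f ht, ih fun _ q r => hk _ _]

theorem eval_congr {a b d : V} {p p' : Pre Γ a b} (h : Face Γ p p') {k : SegmentMap Γ X b d}
    (hk : ∀ ⦃c : V⦄ {q q' : Pre Γ c b}, Face Γ q q' → k q = k q') : H.eval p k = H.eval p' k := by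
  have hzero : ¬(2 / 3 : ℝ) ≤ (0 : I) := by norm_num
  induction h generalizing d with
  | last f g =>
    funext x
    rw [H.eval_cons_of_not_le f hzero, H.eval_of, hk (.last f g), H.eval_of]
  | head f g t p =>
    funext x
    rw [H.eval_cons_of_not_le f hzero]
    by_cases ht : (2 / 3 : ℝ) ≤ t
    · rw [H.eval_cons_of_le g ht, hk (.last f g), H.eval_cons_of_le _ ht]
    · simp only [H.eval_cons_of_not_le _ ht, hk (.head f g t _)]
  | tail f t _ ih =>
    funext x
    by_cases ht : (2 / 3 : ℝ) ≤ t
    · rw [H.eval_cons_of_le f ht, ih fun _ _ _ h => by rw [H.segment_congr h],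
        H.eval_cons_of_le f ht]
    · rw [H.eval_cons_of_not_le f ht, ih fun _ _ _ h => hk (.tail f t h),
        H.eval_cons_of_not_le f ht]

/-- At a parameter `2/3`, where a cut appears, `k` takes the same value before and after the cut. -/
def RespectsCuts {b d : V} (k : SegmentMap Γ X b d) : Prop :=
  ∀ ⦃a c : V⦄ (q : Pre Γ c b) (s : I) (y : Pre Γ a c) (r : I) (x : X a), (s : ℝ) = 2 / 3 →
    k (q.glue s y) r x = k q (σ s) (H.segment y (σ s ⊔ r) x)

theorem eval_cons_of_eq {a b c d : V} (f : Γ.Hom b c) {t : I} (ht : (t : ℝ) = 2 / 3)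
    (p : Pre Γ a b) {k : SegmentMap Γ X c d} (hk : H.RespectsCuts k) (x : X a) :
    k (Pre.of f) (σ t) (H.eval p (fun _ q r => H.segment q (σ t ⊔ r)) x) =
      H.eval p (fun _ q r => k (Pre.cons f t q) r) x := by
  refine (H.apply_eval (k (Pre.of f) (σ t)) p _ x).trans (congrArg (H.eval p · x) ?_)
  funext a q r x
  exact (hk (Pre.of f) t q r x ht).symm

theorem continuous_eval {Z : Type*} [TopologicalSpace Z] {a b d : V} (l : Chain Γ a b)
    {t : Z → Fin l.inner → I} (ht : Continuous t) {x : Z → X a} (hx : Continuous x)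
    {k : Z → SegmentMap Γ X b d}
    (hk : ∀ c, Continuous fun q : Z × Pre Γ c b × I × X c => k q.1 q.2.1 q.2.2.1 q.2.2.2)
    (hcut : ∀ z, H.RespectsCuts (k z)) : Continuous fun z => H.eval ⟨l, t z⟩ (k z) (x z) := by
  induction l generalizing d with
  | single f =>
    exact (hk _).comp (f := fun z => (z, Pre.of f, 0, x z)) (by fun_prop)
  | @cons b _ f l ih =>
    let t₀ (z : Z) : I := t z (0 : Fin (l.inner + 1))
    let p (z : Z) : Pre Γ a b := ⟨l, Fin.tail (n := l.inner) (t z)⟩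
    have ht₀ : Continuous t₀ := (continuous_apply _).comp ht
    have htail : Continuous fun z => Fin.tail (n := l.inner) (t z) :=
      Continuous.finTail (n := l.inner) (A := fun _ => I) ht
    have hcut_at :
        Continuous fun z => H.eval (p z) (fun _ q r => H.segment q (σ (t₀ z) ⊔ r)) (x z) :=
      ih htail (fun c => (H.continuous_segment c b).comp
        (f := fun q : Z × Pre Γ c b × I × X c => (q.2.1, σ (t₀ q.1) ⊔ q.2.2.1, q.2.2.2))
        (by fun_prop)) fun z _ _ q s y r x hs => H.segment_glue q hs y _ r x
    have hcons (c : V) : Continuous fun q : Z × Pre Γ c b × I × X c =>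
        Pre.cons f (t₀ q.1) q.2.1 :=
      (Pre.continuous_cons f).comp ((ht₀.comp continuous_fst).prodMk
        (continuous_fst.comp continuous_snd))
    change Continuous fun z => if (2 / 3 : ℝ) ≤ t₀ z then
        k z (Pre.of f) (σ (t₀ z)) (H.eval (p z) (fun _ q r => H.segment q (σ (t₀ z) ⊔ r)) (x z))
      else H.eval (p z) (fun _ q r => k z (Pre.cons f (t₀ z) q) r) (x z)
    refine Continuous.if_le ?_ ?_ continuous_const (continuous_subtype_val.comp ht₀) fun z hz =>
      H.eval_cons_of_eq f hz.symm (p z) (hcut z) (x z)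
    · exact (hk b).comp (continuous_id.prodMk (continuous_const.prodMk
        ((continuous_symm.comp ht₀).prodMk hcut_at)))
    · exact ih htail (fun c => (hk c).comp
          (f := fun q : Z × Pre Γ c b × I × X c => (q.1, Pre.cons f (t₀ q.1) q.2.1, q.2.2))
          (by fun_prop))
        fun z _ _ q => hcut z (Pre.cons f (t₀ z) q)

theorem continuous_eval_segment (a b : V) :
    Continuous fun q : Pre Γ a b × X a => H.eval q.1 (fun _ => H.segment) q.2 :=
  continuous_sigma_prod fun l => H.continuous_eval l continuous_fst continuous_snd
    (fun c => (H.continuous_segment c b).comp continuous_snd) fun _ _ _ q s y r x hs =>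
      (congrArg (H.segment (q.glue s y) · x) (bot_sup_eq r).symm).trans <|
        (H.segment_glue q hs y 0 r x).trans (congrArg (H.segment q · _) (bot_sup_eq (σ s)))

/-- The functor obtained from `B` by deforming its values at the arrows of `Γ` along `H`. -/
noncomputable def deform : SpaceFunctor (Subcat.whole Γ) X :=
  .ofPre (fun _ _ p => H.eval p fun _ => H.segment)
    (fun _ _ _ _ h => H.eval_congr h fun _ _ _ => H.segment_congr)
    (fun _ _ _ p q x => H.eval_append p q _ x)
    (fun _ _ p => H.eval_base p fun _ => H.segment_base) H.continuous_eval_segment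

theorem deform_map_ofArrow {a b : V} (f : Γ.Hom a b) :
    H.deform.map ⟨W.ofArrow f, trivial⟩ = g f := by
  ext x
  exact H.segment_of_zero f x

end ArrowHomotopy

theorem exists_map_ofArrow_eq (B : SpaceFunctor (Subcat.whole Γ) X)
    (g : ∀ ⦃a b : V⦄, Γ.Hom a b → PtMap (X a) (X b))
    (h : ∀ ⦃a b : V⦄ (f : Γ.Hom a b), (B.map ⟨W.ofArrow f, trivial⟩).cls = (g f).cls) :
    ∃ B' : SpaceFunctor (Subcat.whole Γ) X,
      ∀ ⦃a b : V⦄ (f : Γ.Hom a b), B'.map ⟨W.ofArrow f, trivial⟩ = g f :=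
  let H : ArrowHomotopy B g := fun _ _ f => Classical.choice (Quotient.exact (h f))
  ⟨H.deform, fun _ _ => H.deform_map_ofArrow⟩

/-! ### Vertices as composites of arrows -/

theorem W.target_ne_init {a b : V} (x : W Γ a b) : b ≠ Γ.init := by
  rintro rfl
  exact (x.comp (W.ofArrow (Γ.weak_init a x.ne).some)).ne rfl

theorem W.source_ne_fin {a b : V} (x : W Γ a b) : a ≠ Γ.fin := by
  rintro rfl
  exact ((W.ofArrow (Γ.weak_fin b x.ne.symm).some).comp x).ne rfl

theorem W.ofArrow_ne_comp {a b c : V} (f : Γ.Hom a c) (x : W Γ b c) (y : W Γ a b) :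
    W.ofArrow f ≠ x.comp y := by
  obtain ⟨p⟩ := x
  obtain ⟨q⟩ := y
  intro h
  have hmax : (0 : I) = (p.append q).maxParam :=
    congrArg (Quot.lift Pre.maxParam fun _ _ => Face.maxParam_eq) h
  have hone : 1 ≤ (p.append q).maxParam := p.glue_one q ▸ p.le_maxParam_glue 1 q
  exact absurd (hone.trans_eq hmax.symm) (not_le.2 zero_lt_one)

/-- A morphism of `WΓ` that is a composite of arrows of `Γ`. -/
inductive W.IsArrowComposite : ∀ {a b : V}, W Γ a b → Prop
  | ofArrow {a b : V} (f : Γ.Hom a b) : W.IsArrowComposite (W.ofArrow f)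
  | comp {a b c : V} {x : W Γ b c} {y : W Γ a b} :
      W.IsArrowComposite x → W.IsArrowComposite y → W.IsArrowComposite (x.comp y)

theorem W.cons_one {a b c : V} (f : Γ.Hom b c) (x : W Γ a b) :
    W.cons f 1 x = (W.ofArrow f).comp x := by
  obtain ⟨p⟩ := x
  rfl

theorem W.cons_comp {a b c d : V} (f : Γ.Hom c d) (t : I) (x : W Γ b c) (y : W Γ a b) :
    W.cons f t (x.comp y) = (W.cons f t x).comp y := by
  obtain ⟨p⟩ := x
  obtain ⟨q⟩ := y
  rfl

theorem W.IsArrowComposite.cons_zero {a b c : V} (f : Γ.Hom b c) {x : W Γ a b}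
    (hx : x.IsArrowComposite) : (W.cons f 0 x).IsArrowComposite := by
  induction hx with
  | ofArrow g =>
    have h : W.cons f 0 (W.ofArrow g) = W.ofArrow (Γ.comp f g) := W.mk_eq (.last f g)
    exact h ▸ .ofArrow _
  | comp _ hy ihx _ => exact W.cons_comp f 0 _ _ ▸ (ihx f).comp hy

theorem W.isArrowComposite_mk {a b : V} {p : Pre Γ a b} (hp : ∀ i, p.2 i = 0 ∨ p.2 i = 1) :
    (W.mk p).IsArrowComposite := by
  induction p using Pre.rec_on with
  | of f => exact .ofArrow f
  | cons f t p ih =>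
    have ih := ih fun i => hp i.succ
    obtain rfl | rfl : t = 0 ∨ t = 1 := hp (0 : Fin (p.1.inner + 1))
    · exact ih.cons_zero f
    · rw [W.mk_cons, W.cons_one]
      exact (W.IsArrowComposite.ofArrow f).comp ih

theorem SkMem.mem {k : ℕ} {U : Subcat Γ} {a b : V} {x : W Γ a b} (h : SkMem k U x) :
    x ∈ U.mor a b := by
  induction h with
  | face _ _ _ _ _ hU x hx => exact hU hx
  | comp x y _ _ ihx ihy => exact U.comp_mem ihx ihy

theorem SkMem.isArrowComposite {U : Subcat Γ} {a b : V} {x : W Γ a b} (h : SkMem 0 U x) :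
    x.IsArrowComposite := by
  induction h with
  | face l S e he hS _ x hx =>
    obtain ⟨t, ht, rfl⟩ := hx
    obtain rfl := Finset.card_eq_zero.1 (Nat.le_zero.1 hS)
    have hvertex (i) : t i = 0 ∨ t i = 1 := by
      rw [ht i (Finset.notMem_empty i)]
      exact he i (Finset.notMem_empty i)
    exact W.isArrowComposite_mk hvertex
  | comp x y _ _ ihx ihy => exact ihx.comp ihy

theorem extends_of_ofArrow {B : SpaceFunctor (Subcat.whole Γ) X}
    {F : SpaceFunctor ((Subcat.basis Γ).sk 0) X}
    (hBF : ∀ {a b : V} (f : Γ.Hom a b) (h : ¬(a = Γ.init ∧ b = Γ.fin)),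
      B.map ⟨W.ofArrow f, trivial⟩ = F.map ⟨W.ofArrow f, ofArrow_mem_sk_basis 0 f h⟩) :
    Extends B F := by
  suffices hkey : ∀ {a b : V} {x : W Γ a b}, x.IsArrowComposite → x ∈ (Subcat.basis Γ).mor a b →
      ∃ h : x ∈ ((Subcat.basis Γ).sk 0).mor a b, B.map ⟨x, trivial⟩ = F.map ⟨x, h⟩ from
    fun a b x => (hkey x.2.isArrowComposite x.2.mem).2
  intro a b x hx
  induction hx with
  | ofArrow f =>
    intro hf
    have hne : ¬(_ = Γ.init ∧ _ = Γ.fin) := fun ⟨ha, hb⟩ =>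
      have ⟨_, y, z, _, _, hyz⟩ := hf ha hb
      W.ofArrow_ne_comp f y z hyz
    exact ⟨_, hBF f hne⟩
  | @comp _ b _ x y _ _ ihx ihy =>
    intro _
    obtain ⟨hx, hBx⟩ := ihx fun hb => absurd hb y.target_ne_init
    obtain ⟨hy, hBy⟩ := ihy fun _ hb => absurd hb x.source_ne_fin
    refine ⟨.comp x y hx hy, (B.map_comp ⟨x, trivial⟩ ⟨y, trivial⟩).trans ?_⟩
    rw [hBx, hBy]
    exact (F.map_comp ⟨x, hx⟩ ⟨y, hy⟩).symm

end HigherOps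

theorem proposition3p16 {V : Type u} (Γ : HigherOps.DiagramLattice.{u, v} V)
    (A : HigherOps.InitialData.{u, v, w} Γ)
    (h : ∃ F : HigherOps.SpaceFunctor ((HigherOps.Subcat.basis Γ).sk 0) A.obj,
      HigherOps.IsRealization 0 A F ∧
        ∃ B : HigherOps.SpaceFunctor (HigherOps.Subcat.whole Γ) A.obj, HigherOps.Extends B F)
    (F' : HigherOps.SpaceFunctor ((HigherOps.Subcat.basis Γ).sk 0) A.obj)
    (hF' : HigherOps.IsRealization 0 A F') :
    ∃ B' : HigherOps.SpaceFunctor (HigherOps.Subcat.whole Γ) A.obj, HigherOps.Extends B' F' := by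
  classical
  obtain ⟨F, hF, B, hB⟩ := h
  let g ⦃a b : V⦄ (f : Γ.Hom a b) : HigherOps.PtMap (A.obj a) (A.obj b) :=
    if hf : a = Γ.init ∧ b = Γ.fin then B.map ⟨HigherOps.W.ofArrow f, trivial⟩
    else F'.map ⟨HigherOps.W.ofArrow f, HigherOps.ofArrow_mem_sk_basis 0 f hf⟩
  have hg ⦃a b : V⦄ (f : Γ.Hom a b) :
      (B.map ⟨HigherOps.W.ofArrow f, trivial⟩).cls = (g f).cls := by
    by_cases hf : a = Γ.init ∧ b = Γ.fin
    · rw [show g f = _ from dif_pos hf]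
    · rw [show g f = _ from dif_neg hf, hF' a b f hf, ← hF a b f hf]
      exact congrArg _ (hB a b ⟨_, HigherOps.ofArrow_mem_sk_basis 0 f hf⟩)
  obtain ⟨B', hB'⟩ := HigherOps.exists_map_ofArrow_eq B g hg
  exact ⟨B', HigherOps.extends_of_ofArrow fun f hf => (hB' f).trans (dif_neg hf)⟩
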